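/- Let $\mathcal{O}_S=\mathbb{C}\{x_1,\dots,x_n\}$ be the ring of germs of holomorphic functions on $S=(\mathbb{C}^n,0)$, and let $D=\{h=0\}$ be a reduced divisor germ in $S$, where $0\neq h\in\mathcal{O}_S$, $h(0)=0$ and $\mathcal{O}_D:=\mathcal{O}_S/\mathcal{O}_S h$ is reduced. Let $\mathcal{M}_D$ be the total ring of fractions of $\mathcal{O}_D$, and let $\mathcal{O}_{\widetilde D}\subseteq\mathcal{M}_D$ be the ring of the normalization $\widetilde D$ of $D$, i.e. the integral closure of $\mathcal{O}_D$ in $\mathcal{M}_D$. Define: - the module of logarithmic vector fields $\mathrm{Der}(-\log D):=\{\delta\in\mathrm{Der}_{\mathbb{C}}(\mathcal{O}_S)\mid \delta(h)\in\mathcal{O}_S h\}$; $D$ is called free if this is a free $\mathcal{O}_S$-module; - the module of logarithmic $1$-forms $\Omega^1(\log D):=\{\omega\in\frac1h\Omega^1_S\mid d\omega\in\frac1h\Omega^2_S\}$, where $\Omega^p_S$ denotes the germs of holomorphic $p$-forms; - the module of logarithmic residues $\mathcal{R}_D:=\rho_D(\Omega^1(\log D))\subseteq\mathcal{M}_D$,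 where $\rho_D(\omega):=\frac{\xi}{g}\big|_D$ whenever $\omega=\frac{dh}{h}\cdot\frac{\xi}{g}+\frac{\eta}{g}$ with $\xi,g\in\mathcal{O}_S$, $\eta\in\Omega^1_S$, and $g$ restricting to a non-zero-divisor of $\mathcal{O}_D$ (every $\omega\in\Omega^1(\log D)$ has such a presentation, and $\rho_D(\omega)$ does not depend on it); - the Jacobian ideal $\mathcal{J}_D:=\left\langle\frac{\partial h}{\partial x_1},\dots,\frac{\partial h}{\partial x_n}\right\rangle\subseteq\mathcal{O}_D\subseteq\mathcal{M}_D$; - the conductor $\mathcal{C}_D:=\{f\in\mathcal{M}_D\mid f\cdot\mathcal{O}_{\widetilde D}\subseteq\mathcal{O}_D\}$. If $D$ is free, then $\mathcal{R}_D=\mathcal{O}_{\widetilde D}$ holds if and only if $\mathcal{J}_D=\mathcal{C}_D$ (as $\mathcal{O}_D$-submodules of $\mathcal{M}_D$). -/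

import Mathlib

noncomputable section

namespace LogResidue

open MvPowerSeries

/-- A formal power series over `ℂ` in `n` variables is convergent if it converges absolutely on
some polydisc of positive radius around the origin. -/
def IsConvergent {n : ℕ} (f : MvPowerSeries (Fin n) ℂ) : Prop :=
  ∃ r : ℝ, 0 < r ∧ Summable fun α : Fin n →₀ ℕ => ‖coeff α f‖ * r ^ α.degree

lemma summable_of_le {n : ℕ} {f : MvPowerSeries (Fin n) ℂ} {r s : ℝ} (hs : 0 < s) (hsr : s ≤ r)
    (hf : Summable fun α : Fin n →₀ ℕ => ‖coeff α f‖ * r ^ α.degree) :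
    Summable fun α : Fin n →₀ ℕ => ‖coeff α f‖ * s ^ α.degree := by
  refine Summable.of_nonneg_of_le (fun α => by positivity) (fun α => ?_) hf
  gcongr

lemma isConvergent_C {n : ℕ} (c : ℂ) : IsConvergent (C c : MvPowerSeries (Fin n) ℂ) := by
  classical
  refine ⟨1, one_pos, summable_of_ne_finset_zero (s := {0}) fun α hα => ?_⟩
  have hα' : α ≠ 0 := by simpa using hα
  rw [coeff_C, if_neg hα']
  simp

lemma IsConvergent.add {n : ℕ} {f g : MvPowerSeries (Fin n) ℂ} (hf : IsConvergent f)
    (hg : IsConvergent g) : IsConvergent (f + g) := by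
  obtain ⟨r, hr, hf⟩ := hf
  obtain ⟨s, hs, hg⟩ := hg
  have hm : 0 < min r s := lt_min hr hs
  refine ⟨min r s, hm, Summable.of_nonneg_of_le (fun α => by positivity) (fun α => ?_)
    ((summable_of_le hm (min_le_left r s) hf).add (summable_of_le hm (min_le_right r s) hg))⟩
  rw [map_add, ← add_mul]
  gcongr
  exact norm_add_le _ _

lemma IsConvergent.mul {n : ℕ} {f g : MvPowerSeries (Fin n) ℂ} (hf : IsConvergent f)
    (hg : IsConvergent g) : IsConvergent (f * g) := by
  classical
  obtain ⟨r, hr, hf⟩ := hf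
  obtain ⟨s, hs, hg⟩ := hg
  have hm : 0 < min r s := lt_min hr hs
  have h1 := summable_of_le hm (min_le_left r s) hf
  have h2 := summable_of_le hm (min_le_right r s) hg
  generalize min r s = t at hm h1 h2
  let F : (Fin n →₀ ℕ) → ℝ := fun α => ‖coeff α f‖ * t ^ α.degree
  let G : (Fin n →₀ ℕ) → ℝ := fun α => ‖coeff α g‖ * t ^ α.degree
  have hF : 0 ≤ F := fun α => mul_nonneg (norm_nonneg _) (pow_nonneg hm.le _)
  have hG : 0 ≤ G := fun α => mul_nonneg (norm_nonneg _) (pow_nonneg hm.le _)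
  have h0 : Summable fun x : (Fin n →₀ ℕ) × (Fin n →₀ ℕ) => F x.1 * G x.2 :=
    Summable.mul_of_nonneg (f := F) (g := G) h1 h2 hF hG
  have h3 : Summable fun α => ∑ p ∈ Finset.HasAntidiagonal.antidiagonal α, F p.1 * G p.2 :=
    summable_sum_mul_antidiagonal_of_summable_mul (f := F) (g := G) h0
  refine ⟨t, hm, Summable.of_nonneg_of_le
    (fun α => mul_nonneg (norm_nonneg _) (pow_nonneg hm.le _)) (fun α => ?_) h3⟩
  rw [coeff_mul]
  refine (mul_le_mul_of_nonneg_right (norm_sum_le _ _) (pow_nonneg hm.le _)).trans ?_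
  rw [Finset.sum_mul]
  refine Finset.sum_le_sum fun p hp => le_of_eq ?_
  rw [Finset.HasAntidiagonal.mem_antidiagonal] at hp
  rw [← hp, norm_mul, map_add, pow_add]
  simp only [F, G]
  ring

lemma IsConvergent.pderiv {n : ℕ} {f : MvPowerSeries (Fin n) ℂ} (hf : IsConvergent f)
    (i : Fin n) : IsConvergent (MvPowerSeries.pderiv ℂ i f) := by
  obtain ⟨r, hr, hf⟩ := hf
  have hs : 0 < r / 2 := by positivity
  have hinj : Function.Injective fun α : Fin n →₀ ℕ => α + Finsupp.single i 1 :=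
    add_left_injective _
  have h1 := (hf.comp_injective hinj).mul_left (2 / r)
  refine ⟨r / 2, hs, Summable.of_nonneg_of_le (fun α => by positivity) (fun α => ?_) h1⟩
  have hdeg : (α + Finsupp.single i 1).degree = α.degree + 1 := by simp
  have hle : α i ≤ α.degree := Finsupp.le_degree i α
  have hb : ((α i : ℝ) + 1) ≤ 2 * 2 ^ α.degree := by
    have h2 : α.degree < 2 ^ α.degree := Nat.lt_two_pow_self
    have h3 : α i + 1 ≤ 2 * 2 ^ α.degree := by omega
    exact_mod_cast h3
  have hnorm : ‖((α i : ℂ) + 1)‖ = (α i : ℝ) + 1 := by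
    rw [← Nat.cast_succ, Complex.norm_natCast, Nat.cast_succ]
  simp only [Function.comp_apply, coeff_pderiv, norm_mul, hnorm, hdeg]
  rw [div_pow, pow_succ]
  calc ‖coeff (α + Finsupp.single i 1) f‖ * ((α i : ℝ) + 1) * (r ^ α.degree / 2 ^ α.degree)
      ≤ ‖coeff (α + Finsupp.single i 1) f‖ * (2 * 2 ^ α.degree) *
          (r ^ α.degree / 2 ^ α.degree) := by gcongr
    _ = 2 / r * (‖coeff (α + Finsupp.single i 1) f‖ * (r ^ α.degree * r)) := by field_simp

/-- The ring `ℂ{x₁, …, xₙ}` of convergent power series as a subalgebra of the formal ones. -/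
def convergentSeries (n : ℕ) : Subalgebra ℂ (MvPowerSeries (Fin n) ℂ) where
  carrier := {f | IsConvergent f}
  mul_mem' := IsConvergent.mul
  add_mem' := IsConvergent.add
  algebraMap_mem' c := isConvergent_C c

/-- `𝒪_S` for the germ `S = (ℂⁿ, 0)`: germs at `0` of holomorphic functions, identified with their
Taylor series, i.e. `ℂ{x₁, …, xₙ}`. -/
def OS (n : ℕ) : Type := convergentSeries n

instance instCommRingOS (n : ℕ) : CommRing (OS n) :=
  inferInstanceAs (CommRing (convergentSeries n))

instance instAlgebraOS (n : ℕ) : Algebra ℂ (OS n) :=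
  inferInstanceAs (Algebra ℂ (convergentSeries n))

instance instIsDomainOS (n : ℕ) : IsDomain (OS n) :=
  haveI : IsDomain (MvPowerSeries (Fin n) ℂ) := NoZeroDivisors.to_isDomain _
  Function.Injective.isDomain (convergentSeries n).val.toRingHom Subtype.val_injective

/-- The Taylor series of a germ. -/
def taylor (n : ℕ) : OS n →ₐ[ℂ] MvPowerSeries (Fin n) ℂ := (convergentSeries n).val

/-- The partial derivative `∂/∂xᵢ` on `𝒪_S`. -/
def partialDeriv {n : ℕ} (i : Fin n) : Derivation ℂ (OS n) (OS n) :=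
  Derivation.mk'
    { toFun := fun f => ⟨MvPowerSeries.pderiv ℂ i (taylor n f), IsConvergent.pderiv f.2 i⟩
      map_add' := fun f g => Subtype.ext (map_add (MvPowerSeries.pderiv ℂ i) f.1 g.1)
      map_smul' := fun c f => Subtype.ext ((MvPowerSeries.pderiv ℂ i).map_smul c f.1) }
    fun f g => Subtype.ext ((MvPowerSeries.pderiv ℂ i).leibniz f.1 g.1)

section Fractions

variable {k R : Type} [CommRing k] [CommRing R] [IsDomain R] [Algebra k R]

/-- The ring homomorphism `f ↦ f + ε d(f)` to the dual numbers over the field of fractions. -/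
def jetHom (d : Derivation k R R) : R →+* TrivSqZeroExt (FractionRing R) (FractionRing R) where
  toFun f := TrivSqZeroExt.inl (algebraMap R (FractionRing R) f) +
    TrivSqZeroExt.inr (algebraMap R (FractionRing R) (d f))
  map_one' := by ext <;> simp
  map_zero' := by ext <;> simp
  map_add' f g := by
    ext
    · simp
    · simp only [map_add, TrivSqZeroExt.snd_add, TrivSqZeroExt.snd_inl, TrivSqZeroExt.snd_inr]
      ring
  map_mul' f g := by
    ext
    · simp
    · simp only [map_add, map_mul, Derivation.leibniz, smul_eq_mul, MulOpposite.smul_eq_mul_unop,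
        MulOpposite.unop_op, TrivSqZeroExt.snd_add, TrivSqZeroExt.snd_mul, TrivSqZeroExt.fst_add,
        TrivSqZeroExt.snd_inl, TrivSqZeroExt.snd_inr, TrivSqZeroExt.fst_inl, TrivSqZeroExt.fst_inr]
      ring

lemma isUnit_jetHom (d : Derivation k R R) (y : nonZeroDivisors R) :
    IsUnit (jetHom d (y : R)) := by
  rw [TrivSqZeroExt.isUnit_iff_isUnit_fst]
  simp [jetHom]

/-- The extension of `jetHom` to the field of fractions. -/
def jetHomFrac (d : Derivation k R R) :
    FractionRing R →+* TrivSqZeroExt (FractionRing R) (FractionRing R) :=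
  IsLocalization.lift (M := nonZeroDivisors R) (isUnit_jetHom d)

/-- The unique extension of a derivation of a domain to its field of fractions (the quotient
rule), see `fracDeriv_algebraMap`, `fracDeriv_add` and `fracDeriv_mul`. -/
def fracDeriv (d : Derivation k R R) (f : FractionRing R) : FractionRing R :=
  (jetHomFrac d f).snd

lemma jetHomFrac_fst (d : Derivation k R R) (f : FractionRing R) :
    (jetHomFrac d f).fst = f := by
  have h : (TrivSqZeroExt.fstHom (FractionRing R) (FractionRing R)
      (FractionRing R)).toRingHom.comp (jetHomFrac d) = RingHom.id (FractionRing R) := by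
    refine IsLocalization.ringHom_ext (nonZeroDivisors R) (RingHom.ext fun f => ?_)
    simp [jetHomFrac, jetHom]
  exact RingHom.congr_fun h f

lemma fracDeriv_algebraMap (d : Derivation k R R) (f : R) :
    fracDeriv d (algebraMap R (FractionRing R) f) = algebraMap R (FractionRing R) (d f) := by
  rw [fracDeriv, jetHomFrac, IsLocalization.lift_eq]
  change TrivSqZeroExt.snd (TrivSqZeroExt.inl (algebraMap R (FractionRing R) f) +
    TrivSqZeroExt.inr (algebraMap R (FractionRing R) (d f))) = _
  rw [TrivSqZeroExt.snd_add, TrivSqZeroExt.snd_inl, TrivSqZeroExt.snd_inr, zero_add]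

lemma fracDeriv_add (d : Derivation k R R) (f g : FractionRing R) :
    fracDeriv d (f + g) = fracDeriv d f + fracDeriv d g := by
  simp [fracDeriv]

lemma fracDeriv_mul (d : Derivation k R R) (f g : FractionRing R) :
    fracDeriv d (f * g) = f * fracDeriv d g + g * fracDeriv d f := by
  simp [fracDeriv, jetHomFrac_fst, mul_comm]

end Fractions

/-- The field of germs of meromorphic functions on `S`. -/
abbrev MS (n : ℕ) : Type := FractionRing (OS n)

/-- Meromorphic `1`-forms on `S`; `ω` stands for `∑ i, ω i dxᵢ`. -/
abbrev MeroForm (n : ℕ) : Type := Fin n → MS n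

/-- The coefficient of `dxᵢ ∧ dxⱼ` in the exterior derivative `dω` of a meromorphic `1`-form. -/
def meroExtDeriv {n : ℕ} (ω : MeroForm n) (i j : Fin n) : MS n :=
  fracDeriv (partialDeriv i) (ω j) - fracDeriv (partialDeriv j) (ω i)

/-- The fractional ideal `𝒪_S(D) = h⁻¹ 𝒪_S` of functions with at most a simple pole along the
divisor `D = {h = 0}` (for `h ≠ 0`). -/
def simplePole {n : ℕ} (h : OS n) : Submodule (OS n) (MS n) :=
  Submodule.span (OS n) {(algebraMap (OS n) (MS n) h)⁻¹}

/-- `Der(-log D)`: the vector fields `δ ∈ Θ_S = Der_ℂ(𝒪_S)` with `δ(h) ∈ 𝒪_S h`. -/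
def logDer {n : ℕ} (h : OS n) : Submodule (OS n) (Derivation ℂ (OS n) (OS n)) where
  carrier := {δ | δ h ∈ Ideal.span {h}}
  zero_mem' := by simp
  add_mem' {a b} ha hb := by
    simpa using Ideal.add_mem _ ha hb
  smul_mem' c a ha := by
    simpa using Ideal.mul_mem_left _ c ha

/-- `D` is free: `Der(-log D)` is a free `𝒪_S`-module. -/
def IsFreeDivisor {n : ℕ} (h : OS n) : Prop := Module.Free (OS n) (logDer h)

/-- `𝒪_D = 𝒪_S / (h)`. -/
abbrev OD {n : ℕ} (h : OS n) : Type := OS n ⧸ Ideal.span {h}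

/-- `ℳ_D`, the total ring of fractions of `𝒪_D`. -/
abbrev MD {n : ℕ} (h : OS n) : Type := FractionRing (OD h)

/-- Restriction of a function germ on `S` to `D`, as an element of `ℳ_D`. -/
def restrict {n : ℕ} (h : OS n) : OS n →+* MD h :=
  (algebraMap (OD h) (MD h)).comp (Ideal.Quotient.mk (Ideal.span {h}))

/-- `r ∈ ℳ_D` is a residue of the meromorphic `1`-form `ω` along `D`: one can write
`ω = (dh / h) (ξ / g) + η / g` with `ξ, g ∈ 𝒪_S` and `η ∈ Ω¹_S`, where `g` restricts to a
non-zero-divisor of `𝒪_D`, and `r = (ξ / g)|_D`. Denominators `g` are cleared. -/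
def IsResidue {n : ℕ} (h : OS n) (ω : MeroForm n) (r : MD h) : Prop :=
  ∃ (ξ g : OS n) (η : Fin n → OS n),
    Ideal.Quotient.mk (Ideal.span {h}) g ∈ nonZeroDivisors (OD h) ∧
    (∀ i, algebraMap (OS n) (MS n) g * ω i =
      algebraMap (OS n) (MS n) (partialDeriv i h) / algebraMap (OS n) (MS n) h *
          algebraMap (OS n) (MS n) ξ + algebraMap (OS n) (MS n) (η i)) ∧
    restrict h g * r = restrict h ξ

lemma fracDeriv_algebraMap_mul {n : ℕ} (i : Fin n) (c : OS n) (f : MS n) :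
    fracDeriv (partialDeriv i) (algebraMap (OS n) (MS n) c * f) =
      algebraMap (OS n) (MS n) c * fracDeriv (partialDeriv i) f +
        f * algebraMap (OS n) (MS n) (partialDeriv i c) := by
  rw [fracDeriv_mul, fracDeriv_algebraMap]

/-- `Ω¹(log D)`: the meromorphic `1`-forms `ω` with `ω ∈ Ω¹_S(D)` and `dω ∈ Ω²_S(D)`. -/
def logForms {n : ℕ} (h : OS n) : Submodule (OS n) (MeroForm n) where
  carrier := {ω | (∀ i, ω i ∈ simplePole h) ∧ ∀ i j, meroExtDeriv ω i j ∈ simplePole h}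
  zero_mem' := by
    refine ⟨fun i => zero_mem _, fun i j => ?_⟩
    have e : meroExtDeriv (0 : MeroForm n) i j = 0 := by
      simp [meroExtDeriv, fracDeriv]
    rw [e]
    exact zero_mem _
  add_mem' {ω ω'} hω hω' := by
    refine ⟨fun i => add_mem (hω.1 i) (hω'.1 i), fun i j => ?_⟩
    have e : meroExtDeriv (ω + ω') i j = meroExtDeriv ω i j + meroExtDeriv ω' i j := by
      simp only [meroExtDeriv, Pi.add_apply, fracDeriv_add]
      ring
    rw [e]
    exact add_mem (hω.2 i j) (hω'.2 i j)
  smul_mem' c ω hω := by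
    refine ⟨fun i => Submodule.smul_mem _ c (hω.1 i), fun i j => ?_⟩
    have e : meroExtDeriv (c • ω) i j = c • meroExtDeriv ω i j + partialDeriv i c • ω j -
        partialDeriv j c • ω i := by
      simp only [meroExtDeriv, Pi.smul_apply, Algebra.smul_def, fracDeriv_algebraMap_mul]
      ring
    rw [e]
    exact sub_mem (add_mem (Submodule.smul_mem _ c (hω.2 i j)) (Submodule.smul_mem _ _ (hω.1 j)))
      (Submodule.smul_mem _ _ (hω.1 i))

/-- `ℛ_D = ρ_D(Ω¹(log D)) ⊆ ℳ_D`: the residues of logarithmic `1`-forms along `D`. -/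
def residues {n : ℕ} (h : OS n) : Submodule (OD h) (MD h) where
  carrier := {r | ∃ ω ∈ logForms h, IsResidue h ω r}
  zero_mem' := ⟨0, zero_mem _, 0, 1, 0, by simp, by simp, by simp⟩
  add_mem' := by
    rintro r r' ⟨ω, hω, ξ, g, η, hg, hdec, hr⟩ ⟨ω', hω', ξ', g', η', hg', hdec', hr'⟩
    refine ⟨ω + ω', add_mem hω hω', ξ * g' + ξ' * g, g * g', g' • η + g • η', ?_, fun i => ?_, ?_⟩
    · rw [map_mul]
      exact mul_mem hg hg'
    · have e := hdec i
      have e' := hdec' i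
      simp only [map_add, map_mul, Pi.add_apply, Pi.smul_apply, smul_eq_mul]
      linear_combination algebraMap (OS n) (MS n) g' * e + algebraMap (OS n) (MS n) g * e'
    · simp only [map_add, map_mul]
      linear_combination restrict h g' * hr + restrict h g * hr'
  smul_mem' := by
    rintro a r ⟨ω, hω, ξ, g, η, hg, hdec, hr⟩
    obtain ⟨c, rfl⟩ := Ideal.Quotient.mk_surjective a
    refine ⟨c • ω, Submodule.smul_mem _ c hω, c * ξ, g, c • η, hg, fun i => ?_, ?_⟩
    · have e := hdec i
      simp only [map_mul, Pi.smul_apply, smul_eq_mul, Algebra.smul_def (A := MS n)]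
      linear_combination algebraMap (OS n) (MS n) c * e
    · have e : Ideal.Quotient.mk (Ideal.span {h}) c • r = restrict h c * r := by
        rw [Algebra.smul_def]
        rfl
      rw [e, map_mul]
      linear_combination restrict h c * hr

/-- `𝒪_D̃`, the ring of the normalization of `D`: the integral closure of `𝒪_D` in `ℳ_D`. -/
def normalization {n : ℕ} (h : OS n) : Submodule (OD h) (MD h) :=
  Subalgebra.toSubmodule (integralClosure (OD h) (MD h))

/-- The conductor `𝒞_D = 𝒪_D̃^∨ = {f ∈ ℳ_D | f 𝒪_D̃ ⊆ 𝒪_D}`. -/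
def conductor {n : ℕ} (h : OS n) : Submodule (OD h) (MD h) := 1 / normalization h

/-- The Jacobian ideal `𝒥_D ⊆ 𝒪_D` generated by the classes of all `∂h/∂xᵢ`. -/
def jacobianIdeal {n : ℕ} (h : OS n) : Ideal (OD h) :=
  Ideal.span (Set.range fun i : Fin n => Ideal.Quotient.mk (Ideal.span {h}) (partialDeriv i h))

end LogResidue

end

/-! Write X^∨ = `1 / X` for the dual of an `OD h`-submodule X of `MD h`. The proof rests on three
dualities.

Residues are dual to the Jacobian ideal J (`residues_eq_one_div`): on D, a logarithmic form ∑ aᵢ dxᵢ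
/ h with residue r satisfies r ∂ᵢh = aᵢ. Conversely, lifts aᵢ of the r ∂ᵢh are the numerators of a
logarithmic form with residue r. The conductor C is by definition the dual of the normalization. So
an equality of residues and normalization gives C = J^∨∨, and an equality J = C identifies the
residues with C^∨.

For free D, J^∨∨ = J (`one_div_one_div_le` is the nontrivial inclusion). The coefficients of a basis
of `logDer h` form the Saito matrix M. Since each h ∂ᵢ is logarithmic, M has a partner N with MN =
NM = h, and the syzygies of the ∂ᵢh modulo h are the columns of M. Every row of N is, modulo h, a
multiple of (∂ᵢh); these multiples lie in J^∨, and testing an element of J^∨∨ on them writes it in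
terms of the ∂ᵢh.

If J = C, then C is finitely generated and contains a unit of `MD h`. Elements of C^∨ map C to
itself, because C is an ideal of the normalization; by Cayley–Hamilton they are integral
(`one_div_conductor_le`).

The unit exists because J contains a non-zero-divisor: for a suitable direction v some iterate of
∂_v sends h to a unit, and reducedness then makes ∂_v h regular modulo h
(`mk_derivation_mem_nonZeroDivisors`). -/

noncomputable section

namespace LogResidue

open MvPowerSeries

/-! ### Units of the ring of convergent power series -/

section Units

/-- Shrinking the polydisc makes the part of positive degree of a convergent series small. -/
lemma IsConvergent.exists_sum_le {n : ℕ} {g : MvPowerSeries (Fin n) ℂ} (hg : IsConvergent g)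
    (hg0 : coeff 0 g = 0) :
    ∃ s : ℝ, 0 < s ∧ ∀ B : Finset (Fin n →₀ ℕ), ∑ α ∈ B, ‖coeff α g‖ * s ^ α.degree ≤ 1 / 2 := by
  obtain ⟨r, hr, hs⟩ := hg
  set T := ∑' α, ‖coeff α g‖ * r ^ α.degree with hT
  have hT0 : 0 ≤ T := tsum_nonneg fun α => by positivity
  -- Scaling the radius by t ≤ 1 shrinks each term of positive degree by a factor of at most t, and
  -- t T ≤ 1 / 2.
  set t : ℝ := 1 / (2 * (T + 1)) with ht
  have ht0 : 0 < t := by positivity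
  have ht1 : t ≤ 1 := by
    rw [ht, div_le_one (by positivity)]
    linarith
  refine ⟨t * r, by positivity, fun B => ?_⟩
  calc ∑ α ∈ B, ‖coeff α g‖ * (t * r) ^ α.degree
      ≤ ∑ α ∈ B, t * (‖coeff α g‖ * r ^ α.degree) := by
        refine Finset.sum_le_sum fun α _ => ?_
        by_cases hα : α = 0
        · simp [hα, hg0]
        · have hd : α.degree ≠ 0 := by simpa [Finsupp.degree_eq_zero_iff] using hα
          have h1 : t ^ α.degree ≤ t := pow_le_of_le_one ht0.le ht1 hd
          rw [mul_pow]
          calc ‖coeff α g‖ * (t ^ α.degree * r ^ α.degree)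
              = t ^ α.degree * (‖coeff α g‖ * r ^ α.degree) := by ring
            _ ≤ t * (‖coeff α g‖ * r ^ α.degree) := by gcongr
    _ = t * ∑ α ∈ B, ‖coeff α g‖ * r ^ α.degree := by rw [Finset.mul_sum]
    _ ≤ t * T := by
        gcongr
        exact hs.sum_le_tsum B fun α _ => by positivity
    _ ≤ 1 / 2 := by
        rw [ht, one_div_mul_eq_div, div_le_div_iff₀ (by positivity) (by positivity)]
        linarith

/-- A formal inverse of `1 - g` is convergent if `g` is convergent without constant term. -/
lemma IsConvergent.of_eq_one_add_mul {n : ℕ} {g u : MvPowerSeries (Fin n) ℂ}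
    (hg : IsConvergent g) (hg0 : coeff 0 g = 0) (hu : u = 1 + g * u) : IsConvergent u := by
  classical
  obtain ⟨s, hs, hB⟩ := hg.exists_sum_le hg0
  refine ⟨s, hs, summable_of_sum_le (c := 2) (fun α => by positivity) fun B => ?_⟩
  let U : (Fin n →₀ ℕ) → ℝ := fun α => ‖coeff α u‖ * s ^ α.degree
  let G : (Fin n →₀ ℕ) → ℝ := fun α => ‖coeff α g‖ * s ^ α.degree
  have hU : ∀ α, 0 ≤ U α := fun α => mul_nonneg (norm_nonneg _) (pow_nonneg hs.le _)
  have hG : ∀ α, 0 ≤ G α := fun α => mul_nonneg (norm_nonneg _) (pow_nonneg hs.le _)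
  -- A is finite and closed downwards, so the recursion for the coefficients of u stays inside A. It
  -- yields U(A) ≤ 1 + U(A) / 2 for the finite sum U(A), hence U(A) ≤ 2.
  set A : Finset (Fin n →₀ ℕ) := Finset.Iic (B.sup id) with hA
  have hBA : B ⊆ A := fun α hα => Finset.mem_Iic.2 (Finset.le_sup (f := id) hα)
  have hrec : ∀ α, U α ≤ (if α = 0 then 1 else 0) +
      ∑ p ∈ Finset.HasAntidiagonal.antidiagonal α, G p.1 * U p.2 := by
    intro α
    have e : coeff α u = (if α = 0 then 1 else 0) +
        ∑ p ∈ Finset.HasAntidiagonal.antidiagonal α, coeff p.1 g * coeff p.2 u := by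
      conv_lhs => rw [hu]
      rw [map_add, coeff_mul, coeff_one]
    have e1 : ‖(if α = 0 then (1 : ℂ) else 0)‖ * s ^ α.degree = if α = 0 then 1 else 0 := by
      split_ifs with h0 <;> simp [h0]
    simp only [U]
    rw [e]
    refine (mul_le_mul_of_nonneg_right (norm_add_le _ _) (pow_nonneg hs.le _)).trans ?_
    rw [add_mul, e1]
    gcongr
    refine (mul_le_mul_of_nonneg_right (norm_sum_le _ _) (pow_nonneg hs.le _)).trans ?_
    rw [Finset.sum_mul]
    refine Finset.sum_le_sum fun p hp => le_of_eq ?_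
    rw [Finset.HasAntidiagonal.mem_antidiagonal] at hp
    rw [← hp, norm_mul, map_add, pow_add]
    simp only [G]
    ring
  have hdouble : ∑ α ∈ A, ∑ p ∈ Finset.HasAntidiagonal.antidiagonal α, G p.1 * U p.2 ≤
      (∑ β ∈ A, G β) * ∑ γ ∈ A, U γ := by
    rw [Finset.sum_mul_sum, ← Finset.sum_product', Finset.sum_sigma']
    set S := A.sigma fun α => Finset.HasAntidiagonal.antidiagonal α with hS
    have hinj : Set.InjOn (fun x : (_ : Fin n →₀ ℕ) × (Fin n →₀ ℕ) × (Fin n →₀ ℕ) => x.2) S := by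
      rintro ⟨α, p⟩ hx ⟨α', p'⟩ hx' (rfl : p = p')
      simp only [hS, Finset.coe_sigma, Set.mem_sigma_iff, Finset.mem_coe,
        Finset.HasAntidiagonal.mem_antidiagonal] at hx hx'
      obtain rfl : α = α' := hx.2.symm.trans hx'.2
      rfl
    rw [← Finset.sum_image (f := fun p => G p.1 * U p.2) hinj]
    refine Finset.sum_le_sum_of_subset_of_nonneg (fun p hp => ?_)
      fun p _ _ => mul_nonneg (hG _) (hU _)
    obtain ⟨⟨α, p⟩, hx, rfl⟩ := Finset.mem_image.1 hp
    simp only [hS, Finset.mem_sigma, Finset.HasAntidiagonal.mem_antidiagonal] at hx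
    simp only [Finset.mem_product, hA, Finset.mem_Iic] at hx ⊢
    exact ⟨(hx.2 ▸ le_self_add).trans hx.1, (hx.2 ▸ le_add_self).trans hx.1⟩
  have hone : ∑ α ∈ A, (if α = 0 then (1 : ℝ) else 0) ≤ 1 := by
    rw [Finset.sum_ite_eq']
    split_ifs <;> norm_num
  have hsum : ∑ α ∈ A, U α ≤ 1 + 1 / 2 * ∑ α ∈ A, U α := by
    calc ∑ α ∈ A, U α ≤ ∑ α ∈ A, ((if α = 0 then 1 else 0) +
          ∑ p ∈ Finset.HasAntidiagonal.antidiagonal α, G p.1 * U p.2) :=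
          Finset.sum_le_sum fun α _ => hrec α
      _ ≤ 1 + (∑ β ∈ A, G β) * ∑ γ ∈ A, U γ := by
          rw [Finset.sum_add_distrib]
          exact add_le_add hone hdouble
      _ ≤ 1 + 1 / 2 * ∑ α ∈ A, U α := by
          have h0 : 0 ≤ ∑ α ∈ A, U α := Finset.sum_nonneg fun α _ => hU α
          gcongr
          exact hB A
  calc ∑ α ∈ B, U α ≤ ∑ α ∈ A, U α :=
        Finset.sum_le_sum_of_subset_of_nonneg hBA fun α _ _ => hU α
    _ ≤ 2 := by linarith

lemma taylor_injective (n : ℕ) : Function.Injective (taylor n) := Subtype.val_injective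

/-- A germ which does not vanish at the origin is a unit. -/
lemma isUnit_of_constantCoeff_ne_zero {n : ℕ} {f : OS n}
    (hf : constantCoeff (taylor n f) ≠ 0) : IsUnit f := by
  set c := constantCoeff (taylor n f) with hc
  set v : MvPowerSeries (Fin n) ℂ := (taylor n f)⁻¹ with hv
  have hmul : taylor n f * v = 1 := MvPowerSeries.mul_inv_cancel _ hf
  have hcc : (C c : MvPowerSeries (Fin n) ℂ) * C c⁻¹ = 1 := by
    rw [← map_mul, mul_inv_cancel₀ hf, map_one]
  have hg : IsConvergent (1 - C c⁻¹ * taylor n f) := by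
    have e : (1 - C c⁻¹ * taylor n f : MvPowerSeries (Fin n) ℂ) =
        C 1 + C (-c⁻¹) * taylor n f := by
      simp [sub_eq_add_neg]
    rw [e]
    exact (isConvergent_C _).add ((isConvergent_C _).mul f.2)
  have hg0 : coeff 0 (1 - C c⁻¹ * taylor n f : MvPowerSeries (Fin n) ℂ) = 0 := by
    rw [coeff_zero_eq_constantCoeff_apply]
    simp [← hc, hf]
  have hcv : IsConvergent (C c * v) := by
    -- With g = 1 - f / c, the series `C c * v` is the formal inverse of f / c = 1 - g.
    refine IsConvergent.of_eq_one_add_mul hg hg0 ?_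
    linear_combination hmul + (taylor n f * v) * hcc
  have hvc : IsConvergent v := by
    have e : v = C c⁻¹ * (C c * v) := by linear_combination (-v) * hcc
    rw [e]
    exact (isConvergent_C _).mul hcv
  exact IsUnit.of_mul_eq_one (⟨v, hvc⟩ : OS n) (taylor_injective n hmul)

end Units

/-! ### Vector fields -/

section VectorFields

lemma taylor_partialDeriv {n : ℕ} (i : Fin n) (f : OS n) :
    taylor n (partialDeriv i f) = MvPowerSeries.pderiv ℂ i (taylor n f) := rfl

/-- The germ of the `i`-th coordinate function. -/
def coord {n : ℕ} (i : Fin n) : OS n :=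
  ⟨X i, 1, one_pos, summable_of_ne_finset_zero (s := {Finsupp.single i 1}) fun α hα => by
    classical
    rw [coeff_X, if_neg (by simpa using hα)]
    simp⟩

lemma taylor_coord {n : ℕ} (i : Fin n) : taylor n (coord i) = X i := rfl

lemma partialDeriv_coord {n : ℕ} (i j : Fin n) :
    partialDeriv i (coord j) = if j = i then (1 : OS n) else 0 := by
  apply taylor_injective
  rw [taylor_partialDeriv, taylor_coord]
  split_ifs with hij
  · rw [hij, pderiv_X_self, map_one]
  · rw [pderiv_X_of_ne hij, map_zero]

/-- The part of a power series consisting of the monomials whose first variable is `X i`,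
divided by `X i`. -/
def hadamardPart {n : ℕ} (i : Fin n) (f : MvPowerSeries (Fin n) ℂ) : MvPowerSeries (Fin n) ℂ :=
  fun α => if ∀ j < i, α j = 0 then coeff (α + Finsupp.single i 1) f else 0

lemma coeff_hadamardPart {n : ℕ} (i : Fin n) (f : MvPowerSeries (Fin n) ℂ) (α : Fin n →₀ ℕ) :
    coeff α (hadamardPart i f) =
      if ∀ j < i, α j = 0 then coeff (α + Finsupp.single i 1) f else 0 := rfl

lemma IsConvergent.hadamardPart {n : ℕ} {f : MvPowerSeries (Fin n) ℂ} (hf : IsConvergent f)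
    (i : Fin n) : IsConvergent (hadamardPart i f) := by
  obtain ⟨r, hr, hf⟩ := hf
  have hinj : Function.Injective fun α : Fin n →₀ ℕ => α + Finsupp.single i 1 :=
    add_left_injective _
  refine ⟨r, hr, Summable.of_nonneg_of_le (fun α => by positivity) (fun α => ?_)
    ((hf.comp_injective hinj).mul_left r⁻¹)⟩
  have hdeg : (α + Finsupp.single i 1).degree = α.degree + 1 := by simp
  rw [coeff_hadamardPart]
  split_ifs
  · simp only [Function.comp_apply, hdeg, pow_succ]
    refine le_of_eq ?_
    field_simp
  · simp only [Function.comp_apply, norm_zero, zero_mul]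
    positivity

lemma coeff_X_mul_hadamardPart {n : ℕ} (i : Fin n) (f : MvPowerSeries (Fin n) ℂ)
    (α : Fin n →₀ ℕ) : coeff α (X i * hadamardPart i f) =
      if α i ≠ 0 ∧ ∀ j < i, α j = 0 then coeff α f else 0 := by
  classical
  rw [X, coeff_monomial_mul]
  by_cases hi : α i = 0
  · rw [if_neg, if_neg]
    · tauto
    · intro hle
      have := hle i
      simp [hi] at this
  · have hle : Finsupp.single i 1 ≤ α := by
      rw [Finsupp.single_le_iff]
      omega
    rw [if_pos hle, one_mul, coeff_hadamardPart, tsub_add_cancel_of_le hle]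
    have e : (∀ j < i, (α - Finsupp.single i 1 : Fin n →₀ ℕ) j = 0) ↔ (α i ≠ 0 ∧ ∀ j < i, α j = 0) := by
      constructor
      · intro H
        refine ⟨hi, fun j hj => ?_⟩
        have := H j hj
        rwa [Finsupp.tsub_apply, Finsupp.single_eq_of_ne hj.ne, tsub_zero] at this
      · rintro ⟨-, H⟩ j hj
        simp [H j hj]
    simp only [e]

/-- Each nonconstant monomial is counted exactly once, in the summand of its smallest variable. -/
lemma eq_constantCoeff_add_sum {n : ℕ} (f : MvPowerSeries (Fin n) ℂ) :
    f = C (constantCoeff f) + ∑ i, X i * hadamardPart i f := by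
  classical
  ext α
  rw [map_add, map_sum, coeff_C]
  simp only [coeff_X_mul_hadamardPart]
  by_cases hα : α = 0
  · simp [hα]
  · rw [if_neg hα, zero_add]
    have hne : α.support.Nonempty := Finsupp.support_nonempty_iff.2 hα
    set i := α.support.min' hne with hi
    have hi0 : α i ≠ 0 := Finsupp.mem_support_iff.1 (α.support.min'_mem hne)
    have hmin : ∀ j < i, α j = 0 := fun j hj => by
      by_contra hj0
      exact absurd (α.support.min'_le j (Finsupp.mem_support_iff.2 hj0)) (not_le.2 hj)
    rw [Finset.sum_eq_single i, if_pos ⟨hi0, hmin⟩]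
    · intro j _ hj
      rw [if_neg]
      rintro ⟨hj0, hjmin⟩
      rcases lt_or_gt_of_ne hj with hlt | hgt
      · exact hj0 (hmin j hlt)
      · exact hi0 (hjmin i hgt)
    · simp

/-- Hadamard's lemma for germs of holomorphic functions. -/
lemma exists_eq_algebraMap_add_sum {n : ℕ} (f : OS n) :
    ∃ (c : ℂ) (g : Fin n → OS n), f = algebraMap ℂ (OS n) c + ∑ i, coord i * g i := by
  refine ⟨constantCoeff (taylor n f),
    fun i => ⟨hadamardPart i (taylor n f), IsConvergent.hadamardPart f.2 i⟩, ?_⟩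
  apply taylor_injective
  rw [map_add, map_sum]
  exact eq_constantCoeff_add_sum (taylor n f)

/-- A derivation of `𝒪_S` killing the coordinates is zero. -/
lemma derivation_eq_zero {n : ℕ} (δ : Derivation ℂ (OS n) (OS n))
    (hδ : ∀ i, δ (coord i) = 0) : δ = 0 := by
  classical
  -- No continuity of δ is available. Instead Hadamard's lemma gives δ f = ∑ xᵢ δ(gᵢ), so vanishing
  -- to order k for all germs at once improves to order k + 1.
  have key : ∀ (k : ℕ) (f : OS n) (α : Fin n →₀ ℕ), α.degree < k →
      coeff α (taylor n (δ f)) = 0 := by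
    intro k
    induction k with
    | zero => intro f α hα; omega
    | succ k ih =>
      intro f α hα
      obtain ⟨c, g, rfl⟩ := exists_eq_algebraMap_add_sum f
      rw [map_add, Derivation.map_algebraMap, zero_add, map_sum, map_sum, map_sum]
      refine Finset.sum_eq_zero fun i _ => ?_
      rw [Derivation.leibniz, hδ, smul_zero, add_zero, smul_eq_mul, map_mul, taylor_coord, X,
        coeff_monomial_mul]
      split_ifs with hle
      · rw [one_mul]
        refine ih _ _ ?_
        have := congrArg Finsupp.degree (tsub_add_cancel_of_le hle)
        rw [map_add, Finsupp.degree_single] at this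
        omega
      · rfl
  refine Derivation.ext fun f => taylor_injective n ?_
  ext α
  rw [key (α.degree + 1) f α (Nat.lt_succ_self _)]
  simp

lemma sum_smul_derivation_apply {ι k R : Type*} [CommRing k] [CommRing R] [Algebra k R]
    (s : Finset ι) (c : ι → R) (d : ι → Derivation k R R) (f : R) :
    (∑ i ∈ s, c i • d i) f = ∑ i ∈ s, c i * d i f := by
  classical
  induction s using Finset.induction_on with
  | empty => simp
  | insert a s ha ih => simp [Finset.sum_insert ha, ih]

/-- Every vector field is a combination of the partial derivatives. -/
lemma derivation_eq_sum {n : ℕ} (δ : Derivation ℂ (OS n) (OS n)) :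
    δ = ∑ i, δ (coord i) • partialDeriv i := by
  classical
  refine sub_eq_zero.1 (derivation_eq_zero _ fun j => ?_)
  rw [Derivation.sub_apply, sum_smul_derivation_apply]
  simp [partialDeriv_coord]

lemma derivation_apply {n : ℕ} (δ : Derivation ℂ (OS n) (OS n)) (f : OS n) :
    δ f = ∑ i, δ (coord i) * partialDeriv i f := by
  conv_lhs => rw [derivation_eq_sum δ]
  rw [sum_smul_derivation_apply]

end VectorFields

/-! ### Directional derivatives -/

section Directional

/-- The value at `v` of the homogeneous part of degree `k` of a power series. -/
def homogEval {n : ℕ} (v : Fin n → ℂ) (k : ℕ) (f : MvPowerSeries (Fin n) ℂ) : ℂ :=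
  ∑ α ∈ Finset.univ.finsuppAntidiag k, coeff α f * ∏ i, v i ^ α i

/-- The derivative of germs in the direction `v`. -/
def dirDeriv {n : ℕ} (v : Fin n → ℂ) : Derivation ℂ (OS n) (OS n) :=
  ∑ i, algebraMap ℂ (OS n) (v i) • partialDeriv i

lemma dirDeriv_apply {n : ℕ} (v : Fin n → ℂ) (f : OS n) :
    dirDeriv v f = ∑ i, algebraMap ℂ (OS n) (v i) * partialDeriv i f := by
  rw [dirDeriv, sum_smul_derivation_apply]

lemma homogEval_zero {n : ℕ} (v : Fin n → ℂ) (f : MvPowerSeries (Fin n) ℂ) :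
    homogEval v 0 f = constantCoeff f := by
  simp [homogEval, coeff_zero_eq_constantCoeff_apply]

/-- Comparison of the coefficients of t^k in (∂_v f)(tv) = d/dt f(tv), carried out formally by the
shift α ↦ α + eᵢ. -/
lemma homogEval_dirDeriv {n : ℕ} (v : Fin n → ℂ) (k : ℕ) (f : OS n) :
    homogEval v k (taylor n (dirDeriv v f)) = (k + 1) * homogEval v (k + 1) (taylor n f) := by
  classical
  set F := taylor n f with hF
  set w : (Fin n →₀ ℕ) → ℂ := fun α => coeff α F * ∏ i, v i ^ α i with hw
  have h1 : homogEval v k (taylor n (dirDeriv v f)) =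
      ∑ i, ∑ α ∈ Finset.univ.finsuppAntidiag k, ((α i : ℂ) + 1) * w (α + Finsupp.single i 1) := by
    rw [homogEval, Finset.sum_comm]
    refine Finset.sum_congr rfl fun α _ => ?_
    rw [dirDeriv_apply, map_sum, map_sum, Finset.sum_mul]
    refine Finset.sum_congr rfl fun i _ => ?_
    have e : taylor n (algebraMap ℂ (OS n) (v i) * partialDeriv i f) =
        C (v i) * MvPowerSeries.pderiv ℂ i F := by
      rw [map_mul, taylor_partialDeriv]
      rfl
    have e2 : ∏ j, v j ^ (α + Finsupp.single i 1 : Fin n →₀ ℕ) j = v i * ∏ j, v j ^ α j := by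
      simp only [Finsupp.add_apply, pow_add, Finset.prod_mul_distrib]
      rw [mul_comm, Finset.prod_eq_single i]
      · simp
      · intro j _ hj
        rw [Finsupp.single_eq_of_ne hj, pow_zero]
      · simp
    rw [e, coeff_C_mul, coeff_pderiv]
    simp only [hw]
    rw [e2]
    ring
  have h2 : (k + 1) * homogEval v (k + 1) F =
      ∑ i, ∑ α ∈ Finset.univ.finsuppAntidiag (k + 1), (α i : ℂ) * w α := by
    rw [homogEval, Finset.mul_sum, Finset.sum_comm]
    refine Finset.sum_congr rfl fun α hα => ?_
    rw [← Finset.sum_mul, ← Nat.cast_sum, (Finset.mem_finsuppAntidiag.1 hα).1]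
    push_cast
    rfl
  rw [h1, h2]
  refine Finset.sum_congr rfl fun i _ => ?_
  refine Finset.sum_of_injOn (fun α => α + Finsupp.single i 1)
    ((add_left_injective _).injOn) ?_ ?_ ?_
  · intro α hα
    simp only [Finset.mem_coe, Finset.mem_finsuppAntidiag, Finset.subset_univ, and_true] at hα ⊢
    simp [Finset.sum_add_distrib, hα, Finsupp.single_apply]
  · intro α hα hni
    have : α i = 0 := by
      by_contra hi
      refine hni ⟨α - Finsupp.single i 1, ?_, ?_⟩
      · have hle : Finsupp.single i 1 ≤ α := by
          rw [Finsupp.single_le_iff]; omega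
        simp only [Finset.mem_coe, Finset.mem_finsuppAntidiag, Finset.subset_univ,
          and_true] at hα ⊢
        have e : ∑ j, α j = ∑ j, (α - Finsupp.single i 1 : Fin n →₀ ℕ) j + 1 := by
          conv_lhs => rw [← tsub_add_cancel_of_le hle]
          simp only [Finsupp.add_apply, Finset.sum_add_distrib]
          simp [Finsupp.single_apply]
        rw [hα] at e
        exact (Nat.succ.inj e).symm
      · exact tsub_add_cancel_of_le (by rw [Finsupp.single_le_iff]; omega)
    simp [this]
  · intro α _
    simp

/-- Taylor's formula along the line through v; a nonvanishing homogeneous part thus makes an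
iterated derivative a unit. -/
lemma constantCoeff_iterate_dirDeriv {n : ℕ} (v : Fin n → ℂ) (k : ℕ) (f : OS n) :
    constantCoeff (taylor n ((dirDeriv v)^[k] f)) =
      (k.factorial : ℂ) * homogEval v k (taylor n f) := by
  induction k generalizing f with
  | zero => simp [homogEval_zero]
  | succ k ih =>
    rw [Function.iterate_succ_apply, ih, homogEval_dirDeriv, Nat.factorial_succ]
    push_cast
    ring

/-- A nonzero homogeneous part is a nonzero polynomial, and over the infinite field ℂ it cannot
vanish everywhere. -/
lemma exists_homogEval_ne_zero {n : ℕ} {f : MvPowerSeries (Fin n) ℂ} (hf : f ≠ 0) :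
    ∃ v k, homogEval v k f ≠ 0 := by
  classical
  obtain ⟨β, hβ⟩ : ∃ β, coeff β f ≠ 0 := by
    by_contra! H
    exact hf (MvPowerSeries.ext fun α => by simpa using H α)
  set k := ∑ i, β i with hk
  set p : MvPolynomial (Fin n) ℂ :=
    ∑ α ∈ Finset.univ.finsuppAntidiag k, MvPolynomial.monomial α (coeff α f) with hp
  have hp0 : p ≠ 0 := by
    intro h0
    have : MvPolynomial.coeff β p = coeff β f := by
      rw [hp, MvPolynomial.coeff_sum, Finset.sum_eq_single β]
      · simp
      · intro α _ hα
        rw [MvPolynomial.coeff_monomial, if_neg hα]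
      · intro H
        exact absurd (Finset.mem_finsuppAntidiag.2 ⟨hk.symm, Finset.subset_univ _⟩) H
    rw [h0, MvPolynomial.coeff_zero] at this
    exact hβ this.symm
  obtain ⟨v, hv⟩ : ∃ v, MvPolynomial.eval v p ≠ 0 := by
    by_contra! H
    exact hp0 (MvPolynomial.funext fun v => by simpa using H v)
  refine ⟨v, k, ?_⟩
  convert hv using 1
  rw [hp, map_sum, homogEval]
  refine Finset.sum_congr rfl fun α _ => ?_
  rw [MvPolynomial.eval_monomial, Finsupp.prod_fintype _ _ (fun i => pow_zero _)]

/-- If `δ` is a derivation some iterate of which maps `h` to a unit, then `δ h` is a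
non-zero-divisor modulo `h`, provided that `R / h` is reduced. -/
lemma mk_derivation_mem_nonZeroDivisors {k R : Type*} [CommRing k] [CommRing R] [Algebra k R]
    (δ : Derivation k R R) {h : R} [IsReduced (R ⧸ Ideal.span {h})] {m : ℕ}
    (hm : IsUnit (δ^[m] h)) :
    Ideal.Quotient.mk (Ideal.span {h}) (δ h) ∈ nonZeroDivisors (R ⧸ Ideal.span {h}) := by
  rw [mem_nonZeroDivisors_iff_right]
  intro x hx
  obtain ⟨a, rfl⟩ := Ideal.Quotient.mk_surjective x
  rw [← map_mul, Ideal.Quotient.eq_zero_iff_mem] at hx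
  -- Apply δ to a^l f = h g and multiply by a: the terms containing δ h and δ a become multiples of
  -- h by `hb` and `hg`. At j = m the unit drops out, leaving a^l in (h).
  have stable : ∀ j, ∃ l, a ^ l * δ^[j] h ∈ Ideal.span {h} := by
    intro j
    induction j with
    | zero => exact ⟨0, by simp⟩
    | succ j ih =>
      obtain ⟨l, hl⟩ := ih
      refine ⟨l + 1, ?_⟩
      obtain ⟨g, hg⟩ := Ideal.mem_span_singleton.1 hl
      obtain ⟨b, hb⟩ := Ideal.mem_span_singleton.1 hx
      rw [Function.iterate_succ_apply']
      set f := δ^[j] h with hf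
      have hd := congrArg δ hg
      rw [Derivation.leibniz, Derivation.leibniz, Derivation.leibniz_pow] at hd
      simp only [smul_eq_mul, nsmul_eq_mul] at hd
      refine Ideal.mem_span_singleton.2 ⟨a * δ g + g * b - l * g * δ a, ?_⟩
      -- The Leibniz rule for powers involves the truncated exponent l - 1.
      rcases l with _ | l
      · simp only [pow_zero, Nat.cast_zero, zero_mul, mul_zero, add_zero, one_mul] at hd hg ⊢
        linear_combination a * hd + g * hb
      · simp only [Nat.add_sub_cancel] at hd
        push_cast at hd ⊢
        linear_combination a * hd + g * hb - ((l : R) + 1) * δ a * hg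
  obtain ⟨l, hl⟩ := stable m
  rw [Ideal.mul_unit_mem_iff_mem _ hm] at hl
  refine (IsReduced.eq_zero _ ⟨l, ?_⟩)
  rw [← map_pow, Ideal.Quotient.eq_zero_iff_mem]
  exact hl

/-- The Jacobian ideal of a reduced divisor contains a non-zero-divisor. -/
lemma exists_mem_jacobianIdeal_nonZeroDivisors {n : ℕ} {h : OS n} (h_ne : h ≠ 0)
    (h_red : IsReduced (OD h)) : ∃ s ∈ jacobianIdeal h, s ∈ nonZeroDivisors (OD h) := by
  obtain ⟨v, k, hvk⟩ := exists_homogEval_ne_zero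
    (fun h0 => h_ne (taylor_injective n (h0.trans (map_zero (taylor n)).symm)))
  refine ⟨Ideal.Quotient.mk _ (dirDeriv v h), ?_,
    mk_derivation_mem_nonZeroDivisors (m := k) (dirDeriv v) (isUnit_of_constantCoeff_ne_zero ?_)⟩
  · rw [dirDeriv_apply, map_sum]
    refine Ideal.sum_mem _ fun i _ => ?_
    rw [map_mul]
    exact Ideal.mul_mem_left _ _ (Ideal.subset_span ⟨i, rfl⟩)
  · rw [constantCoeff_iterate_dirDeriv]
    exact mul_ne_zero (Nat.cast_ne_zero.2 k.factorial_ne_zero) hvk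

end Directional

/-! ### Residues as the dual of the Jacobian ideal -/

section Residues

variable {n : ℕ} {h : OS n}

lemma restrict_eq_zero_iff {f : OS n} : restrict h f = 0 ↔ h ∣ f := by
  rw [restrict, RingHom.comp_apply,
    IsFractionRing.to_map_eq_zero_iff, Ideal.Quotient.eq_zero_iff_mem, Ideal.mem_span_singleton]

lemma isUnit_restrict {g : OS n}
    (hg : Ideal.Quotient.mk (Ideal.span {h}) g ∈ nonZeroDivisors (OD h)) :
    IsUnit (restrict h g) :=
  IsLocalization.map_units (MD h) (⟨_, hg⟩ : nonZeroDivisors (OD h))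

lemma dvd_of_dvd_mul_left_of_regular {f g : OS n}
    (hg : Ideal.Quotient.mk (Ideal.span {h}) g ∈ nonZeroDivisors (OD h)) (hd : h ∣ g * f) :
    h ∣ f := by
  rw [← restrict_eq_zero_iff] at hd ⊢
  rw [map_mul] at hd
  exact (isUnit_restrict hg).mul_right_eq_zero.1 hd

lemma mem_one_iff_restrict {r : MD h} :
    r ∈ (1 : Submodule (OD h) (MD h)) ↔ r ∈ (restrict h).range := by
  rw [Submodule.mem_one, RingHom.mem_range]
  constructor
  · rintro ⟨y, rfl⟩
    obtain ⟨a, rfl⟩ := Ideal.Quotient.mk_surjective y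
    exact ⟨a, rfl⟩
  · rintro ⟨a, rfl⟩
    exact ⟨_, rfl⟩

variable (h) in
lemma coeSubmodule_jacobianIdeal :
    IsLocalization.coeSubmodule (MD h) (jacobianIdeal h) =
      Submodule.span (OD h) (Set.range fun i => restrict h (partialDeriv i h)) := by
  rw [jacobianIdeal, IsLocalization.coeSubmodule_span, ← Set.range_comp]
  rfl

lemma mem_one_div_jacobianIdeal {r : MD h} :
    r ∈ 1 / IsLocalization.coeSubmodule (MD h) (jacobianIdeal h) ↔
      ∀ i, r * restrict h (partialDeriv i h) ∈ (restrict h).range := by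
  rw [Submodule.mem_div_iff_forall_mul_mem, coeSubmodule_jacobianIdeal]
  simp only [← mem_one_iff_restrict]
  constructor
  · intro H i
    exact H _ (Submodule.subset_span ⟨i, rfl⟩)
  · intro H y hy
    induction hy using Submodule.span_induction with
    | mem x hx =>
      obtain ⟨i, rfl⟩ := hx
      exact H i
    | zero => simp
    | add x y _ _ hx hy => rw [mul_add]; exact add_mem hx hy
    | smul a x _ hx => rw [mul_smul_comm]; exact Submodule.smul_mem _ a hx

lemma mem_simplePole_iff {f : MS n} :
    f ∈ simplePole h ↔
      ∃ a : OS n, f = algebraMap (OS n) (MS n) a / algebraMap (OS n) (MS n) h := by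
  rw [simplePole, Submodule.mem_span_singleton]
  refine exists_congr fun a => ?_
  rw [Algebra.smul_def, div_eq_mul_inv, eq_comm]

lemma fracDeriv_div (h_ne : h ≠ 0) (i : Fin n) (a : OS n) :
    fracDeriv (partialDeriv i) (algebraMap (OS n) (MS n) a / algebraMap (OS n) (MS n) h) =
      (algebraMap (OS n) (MS n) (partialDeriv i a) -
        algebraMap (OS n) (MS n) a / algebraMap (OS n) (MS n) h *
          algebraMap (OS n) (MS n) (partialDeriv i h)) / algebraMap (OS n) (MS n) h := by
  have hh : algebraMap (OS n) (MS n) h ≠ 0 := by simpa using h_ne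
  have e := fracDeriv_algebraMap_mul i h
    (algebraMap (OS n) (MS n) a / algebraMap (OS n) (MS n) h)
  rw [mul_div_cancel₀ _ hh, fracDeriv_algebraMap] at e
  rw [eq_div_iff hh]
  linear_combination -e

/-- A form `a / h` is logarithmic as soon as `dh ∧ a` is divisible by `h`. -/
lemma div_mem_logForms (h_ne : h ≠ 0) {a : Fin n → OS n}
    (ha : ∀ i j, h ∣ a j * partialDeriv i h - a i * partialDeriv j h) :
    (fun i => algebraMap (OS n) (MS n) (a i) / algebraMap (OS n) (MS n) h) ∈ logForms h := by
  have hh : algebraMap (OS n) (MS n) h ≠ 0 := by simpa using h_ne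
  refine ⟨fun i => mem_simplePole_iff.2 ⟨a i, rfl⟩, fun i j => mem_simplePole_iff.2 ?_⟩
  obtain ⟨c, hc⟩ := ha i j
  -- From d(a / h) = (da - (dh ∧ a) / h) / h, where c is the coefficient of (dh ∧ a) / h.
  refine ⟨partialDeriv i (a j) - partialDeriv j (a i) - c, ?_⟩
  have hc' := congrArg (algebraMap (OS n) (MS n)) hc
  simp only [map_sub, map_mul] at hc'
  rw [meroExtDeriv, fracDeriv_div h_ne, fracDeriv_div h_ne]
  simp only [map_sub]
  field_simp
  linear_combination -hc'

/-- The module of logarithmic residues is the dual of the Jacobian ideal. -/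
lemma residues_eq_one_div (h_ne : h ≠ 0) :
    residues h = 1 / IsLocalization.coeSubmodule (MD h) (jacobianIdeal h) := by
  have hh : algebraMap (OS n) (MS n) h ≠ 0 := by simpa using h_ne
  have hinj : Function.Injective (algebraMap (OS n) (MS n)) := IsFractionRing.injective _ _
  ext r
  rw [mem_one_div_jacobianIdeal]
  constructor
  · rintro ⟨ω, hω, ξ, g, η, hg, hdec, hr⟩ i
    obtain ⟨a, ha⟩ := mem_simplePole_iff.1 (hω.1 i)
    refine ⟨a, ?_⟩
    -- On D this reads g a = ξ ∂ᵢh = g r ∂ᵢh, and g cancels.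
    have e : g * a = partialDeriv i h * ξ + h * η i := by
      apply hinj
      have e := hdec i
      rw [ha] at e
      simp only [map_mul, map_add]
      field_simp at e
      linear_combination e
    have e' := congrArg (restrict h) e
    rw [map_mul, map_add, map_mul, map_mul, restrict_eq_zero_iff.2 dvd_rfl] at e'
    refine (isUnit_restrict hg).mul_left_cancel ?_
    linear_combination e' - restrict h (partialDeriv i h) * hr
  · intro H
    choose a ha using H
    obtain ⟨x, ⟨y, hy⟩, rfl⟩ := IsLocalization.exists_mk'_eq (nonZeroDivisors (OD h)) r
    obtain ⟨ξ, rfl⟩ := Ideal.Quotient.mk_surjective x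
    obtain ⟨g, rfl⟩ := Ideal.Quotient.mk_surjective y
    set r := IsLocalization.mk' (MD h) (Ideal.Quotient.mk (Ideal.span {h}) ξ)
      (⟨_, hy⟩ : nonZeroDivisors (OD h)) with hr
    have hgr : restrict h g * r = restrict h ξ :=
      IsLocalization.mk'_spec' (MD h) (Ideal.Quotient.mk (Ideal.span {h}) ξ)
        (⟨_, hy⟩ : nonZeroDivisors (OD h))
    have hη : ∀ i, ∃ η, g * a i - partialDeriv i h * ξ = h * η := fun i => by
      change h ∣ _
      rw [← restrict_eq_zero_iff, map_sub, map_mul, map_mul, ha]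
      linear_combination restrict h (partialDeriv i h) * hgr
    choose η hη using hη
    -- Since g a = ξ dh + h η, the form g (dh ∧ a) = h (dh ∧ η) is divisible by h; as g is regular
    -- modulo h, so is dh ∧ a.
    refine ⟨fun i => algebraMap (OS n) (MS n) (a i) / algebraMap (OS n) (MS n) h,
      div_mem_logForms h_ne fun i j => dvd_of_dvd_mul_left_of_regular hy
        ⟨η j * partialDeriv i h - η i * partialDeriv j h, ?_⟩,
      ξ, g, η, hy, fun i => ?_, hgr⟩
    · linear_combination partialDeriv i h * hη j - partialDeriv j h * hη i
    · have e := congrArg (algebraMap (OS n) (MS n)) (hη i)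
      simp only [map_sub, map_mul] at e
      field_simp
      linear_combination e

end Residues

/-! ### Reflexivity of the Jacobian ideal of a free divisor -/

section Reflexive

/-- An ideal of `R / h` with generators `j` whose syzygies are generated by the columns of a matrix
`M` that is part of a matrix factorization of `h` is reflexive, if it contains a unit of the
overring `K` in which duals are formed. -/
lemma exists_eq_sum_of_matrixFactorization {R K ι κ : Type*} [CommRing R] [IsDomain R] [CommRing K]
    [Fintype ι] [Fintype κ] [DecidableEq ι] [DecidableEq κ] {ρ : R →+* K} {h : R} (h_ne : h ≠ 0)
    (hρ : ∀ f, ρ f = 0 ↔ h ∣ f) {j : ι → R} {M : Matrix ι κ R} {N : Matrix κ ι R}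
    (hMN : M * N = h • (1 : Matrix ι ι R)) (hNM : N * M = h • (1 : Matrix κ κ R))
    (hjM : ∀ k, h ∣ ∑ i, j i * M i k)
    (hsyz : ∀ c : ι → R, h ∣ ∑ i, c i * j i → ∃ d : κ → R, c = M.mulVec d)
    {c : ι → R} (hc : IsUnit (ρ (∑ i, c i * j i))) {f : K}
    (hf : ∀ r, (∀ i, r * ρ (j i) ∈ ρ.range) → f * r ∈ ρ.range) :
    ∃ a : ι → R, f = ∑ i, ρ (a i) * ρ (j i) := by
  have cancel : ∀ x : K, (∀ i, x * ρ (j i) = 0) → x = 0 := by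
    intro x hx
    refine hc.mul_left_eq_zero.1 ?_
    rw [map_sum, Finset.mul_sum]
    refine Finset.sum_eq_zero fun i _ => ?_
    rw [map_mul]
    linear_combination ρ (c i) * hx i
  have hNMd : ∀ d : κ → R, N.mulVec (M.mulVec d) = h • d := fun d => by
    rw [Matrix.mulVec_mulVec, hNM, Matrix.smul_mulVec, Matrix.one_mulVec]
  -- The Koszul syzygy jᵢ e_l - j_l eᵢ equals M d, and N sends it to h d. So each row of N is
  -- proportional to j modulo h.
  have hminor : ∀ k i l, ρ (N k l) * ρ (j i) = ρ (N k i) * ρ (j l) := by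
    intro k i l
    obtain ⟨d, hd⟩ := hsyz (Pi.single l (j i) - Pi.single i (j l)) (by
      simp [sub_mul, Finset.sum_sub_distrib, Pi.single_apply, mul_comm (j i)])
    have e := congrFun (hNMd d) k
    rw [← hd, Matrix.mulVec_sub] at e
    simp only [Pi.sub_apply, Matrix.mulVec_single, Pi.smul_apply, smul_eq_mul] at e
    rw [← sub_eq_zero, ← map_mul, ← map_mul, ← map_sub, hρ]
    exact ⟨d k, by simpa using e⟩
  -- The proportionality factor is found by pairing row k and j with c and dividing by the unit ∑ cᵢ
  -- jᵢ.
  have hr : ∀ k, ∃ r : K, ∀ i, r * ρ (j i) = ρ (N k i) := by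
    intro k
    obtain ⟨w, hw⟩ := hc
    refine ⟨ρ (∑ l, c l * N k l) * ↑w⁻¹, fun i => ?_⟩
    have e : ρ (∑ l, c l * N k l) * ρ (j i) = ρ (N k i) * w := by
      rw [hw, map_sum, map_sum, Finset.sum_mul, Finset.mul_sum]
      refine Finset.sum_congr rfl fun l _ => ?_
      rw [map_mul, map_mul]
      linear_combination ρ (c l) * hminor k i l
    linear_combination (↑w⁻¹ : K) * e + ρ (N k i) * w.mul_inv
  choose r hr using hr
  choose u hu using hjM
  choose b hb using fun k => hf (r k) fun i => ⟨N k i, (hr k i).symm⟩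
  have huN : ∀ l, ∑ k, u k * N k l = j l := by
    intro l
    refine mul_left_cancel₀ h_ne ?_
    calc h * ∑ k, u k * N k l = ∑ k, (∑ i, j i * M i k) * N k l := by
          rw [Finset.mul_sum]
          exact Finset.sum_congr rfl fun k _ => by rw [hu k, mul_assoc]
      _ = ∑ i, j i * (M * N) i l := by
          simp only [Finset.sum_mul, Matrix.mul_apply, Finset.mul_sum]
          rw [Finset.sum_comm]
          simp only [mul_assoc]
      _ = h * j l := by
          rw [hMN]
          simp [Matrix.one_apply, mul_comm]
  -- Multiplied by jᵢ this is u N = j, which comes from j M = h u and M N = h.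
  have hur : ∑ k, ρ (u k) * r k = 1 := by
    refine sub_eq_zero.1 (cancel _ fun i => ?_)
    have e : ρ (j i) = ∑ k, ρ (u k * N k i) := by rw [← huN i, map_sum]
    rw [sub_mul, one_mul, Finset.sum_mul, sub_eq_zero, e]
    refine Finset.sum_congr rfl fun k _ => ?_
    rw [← e, mul_assoc, hr, map_mul]
  -- Multiplied by j_l this is the entry (i, l) of M N = h, which vanishes in K.
  have hMr : ∀ i, ∑ k, ρ (M i k) * r k = 0 := by
    intro i
    refine cancel _ fun l => ?_
    have e : (∑ k, ρ (M i k) * r k) * ρ (j l) = ρ ((M * N) i l) := by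
      rw [Finset.sum_mul, Matrix.mul_apply, map_sum]
      refine Finset.sum_congr rfl fun k _ => ?_
      rw [mul_assoc, hr, map_mul]
    rw [e, hMN, hρ]
    exact ⟨(1 : Matrix ι ι R) i l, by simp⟩
  -- As b lifts f r, M b restricts to f M r = 0. Writing M b = h a and applying N gives b = N a,
  -- whence f = f (u · r) = u N a = j · a in K.
  have hMb : ∀ i, h ∣ M.mulVec b i := by
    intro i
    rw [← hρ]
    calc ρ (M.mulVec b i) = f * ∑ k, ρ (M i k) * r k := by
          simp only [Matrix.mulVec, dotProduct, map_sum, map_mul, hb, Finset.mul_sum]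
          exact Finset.sum_congr rfl fun k _ => by ring
      _ = 0 := by rw [hMr, mul_zero]
  choose a ha using hMb
  have hbN : ∀ k, b k = ∑ i, N k i * a i := by
    intro k
    refine mul_left_cancel₀ h_ne ?_
    have e := congrFun (hNMd b) k
    have hfun : M.mulVec b = h • a := funext ha
    rw [hfun, Matrix.mulVec_smul] at e
    exact e.symm
  refine ⟨a, ?_⟩
  calc f = f * ∑ k, ρ (u k) * r k := by rw [hur, mul_one]
    _ = ∑ k, ρ (u k) * ρ (b k) := by
        simp only [hb, Finset.mul_sum]
        exact Finset.sum_congr rfl fun k _ => mul_left_comm _ _ _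
    _ = ρ (∑ k, u k * ∑ i, N k i * a i) := by
        rw [map_sum]
        exact Finset.sum_congr rfl fun k _ => by rw [map_mul, hbN]
    _ = ρ (∑ i, a i * ∑ k, u k * N k i) := by
        simp only [Finset.mul_sum]
        rw [Finset.sum_comm]
        congr 1
        exact Finset.sum_congr rfl fun i _ => Finset.sum_congr rfl fun k _ => by ring
    _ = ∑ i, ρ (a i) * ρ (j i) := by
        simp only [huN, map_sum, map_mul]

variable {n : ℕ} {h : OS n}

lemma mem_logDer {δ : Derivation ℂ (OS n) (OS n)} : δ ∈ logDer h ↔ h ∣ δ h :=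
  Ideal.mem_span_singleton

/-- The basis stays linearly independent among all vector fields, which are spanned by the n partial
derivatives. -/
lemma finite_of_basis_logDer {κ : Type*} (b : Module.Basis κ (OS n) (logDer h)) : Finite κ := by
  have hli : LinearIndependent (OS n) fun k => (b k : Derivation ℂ (OS n) (OS n)) :=
    b.linearIndependent.map' (logDer h).subtype (Submodule.ker_subtype _)
  refine hli.finite_of_le_span_finite _
    (Set.range (partialDeriv : Fin n → Derivation ℂ (OS n) (OS n))) ?_
  rintro δ -
  rw [derivation_eq_sum δ]
  exact Submodule.sum_mem _ fun i _ => Submodule.smul_mem _ _ (Submodule.subset_span ⟨i, rfl⟩)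

/-- The Jacobian ideal of a reduced free divisor contains its bidual. -/
lemma one_div_one_div_le (h_ne : h ≠ 0) (h_red : IsReduced (OD h)) (h_free : IsFreeDivisor h) :
    1 / (1 / IsLocalization.coeSubmodule (MD h) (jacobianIdeal h)) ≤
      IsLocalization.coeSubmodule (MD h) (jacobianIdeal h) := by
  classical
  intro f hf
  rw [Submodule.mem_div_iff_forall_mul_mem] at hf
  have hfree : Module.Free (OS n) (logDer h) := h_free
  set b := Module.Free.chooseBasis (OS n) (logDer h) with hb
  have := finite_of_basis_logDer b
  cases nonempty_fintype (Module.Free.ChooseBasisIndex (OS n) (logDer h))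
  have hsmul : ∀ i, h • partialDeriv i ∈ logDer h := fun i =>
    mem_logDer.2 ⟨partialDeriv i h, rfl⟩
  -- M is the Saito matrix: its columns are the basis fields in terms of the ∂ᵢ. The columns of N
  -- express the fields h ∂ᵢ in the basis.
  set M : Matrix (Fin n) _ (OS n) := fun i k => (b k).1 (coord i) with hM
  set N : Matrix _ (Fin n) (OS n) := fun k i => b.repr ⟨_, hsmul i⟩ k with hN
  have hrepr : ∀ (δ : logDer h) (g : OS n), δ.1 g = ∑ k, b.repr δ k * (b k).1 g := by
    intro δ g
    conv_lhs => rw [← b.sum_repr δ]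
    rw [Submodule.coe_sum]
    simp only [Submodule.coe_smul]
    rw [sum_smul_derivation_apply]
  have hMN : M * N = h • (1 : Matrix (Fin n) (Fin n) (OS n)) := by
    ext i l
    rw [Matrix.mul_apply, Matrix.smul_apply, smul_eq_mul]
    calc ∑ k, M i k * N k l = ∑ k, b.repr ⟨_, hsmul l⟩ k * (b k).1 (coord i) :=
          Finset.sum_congr rfl fun k _ => mul_comm _ _
      _ = (h • partialDeriv l : Derivation ℂ (OS n) (OS n)) (coord i) := (hrepr _ _).symm
      _ = h * (1 : Matrix (Fin n) (Fin n) (OS n)) i l := by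
          rw [Derivation.smul_apply, partialDeriv_coord, smul_eq_mul, Matrix.one_apply]
  have hNM : N * M = h • (1 : Matrix _ _ (OS n)) := by
    ext k l
    have e : ∑ i, (b l).1 (coord i) • (⟨_, hsmul i⟩ : logDer h) = h • b l := by
      apply Subtype.ext
      rw [Submodule.coe_sum, Submodule.coe_smul]
      conv_rhs => rw [derivation_eq_sum (b l).1, Finset.smul_sum]
      exact Finset.sum_congr rfl fun i _ => smul_comm _ _ _
    have e' := DFunLike.congr_fun (congrArg b.repr e) k
    rw [map_sum, Finsupp.finsetSum_apply, map_smul, b.repr_self] at e'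
    simp only [map_smul, Finsupp.smul_apply, smul_eq_mul] at e'
    rw [Matrix.mul_apply, Matrix.smul_apply, smul_eq_mul, Matrix.one_apply]
    rw [Finsupp.single_apply] at e'
    simp only [hN, hM, eq_comm (a := k)]
    rw [← e']
    exact Finset.sum_congr rfl fun i _ => mul_comm _ _
  obtain ⟨s, hsJ, hs⟩ := exists_mem_jacobianIdeal_nonZeroDivisors h_ne h_red
  obtain ⟨c, hc⟩ := (Ideal.mem_span_range_iff_exists_fun).1 hsJ
  choose c' hc' using fun i => Ideal.Quotient.mk_surjective (c i)
  have hunit : IsUnit (restrict h (∑ i, c' i * partialDeriv i h)) := by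
    refine isUnit_restrict ?_
    convert hs using 1
    rw [← hc, map_sum]
    exact Finset.sum_congr rfl fun i _ => by rw [map_mul, hc']
  obtain ⟨a, rfl⟩ := exists_eq_sum_of_matrixFactorization (ρ := restrict h) h_ne
    (fun f => restrict_eq_zero_iff) (j := fun i => partialDeriv i h) hMN hNM
    (fun k => by
      have e := mem_logDer.1 (b k).2
      rw [derivation_apply] at e
      simpa only [hM, mul_comm] using e)
    -- A syzygy c of the ∂ᵢh modulo h is the same as a logarithmic field ∑ cᵢ ∂ᵢ, and d is its
    -- coordinate vector.
    (fun c hc => by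
      have hδ : ∑ i, c i • partialDeriv i ∈ logDer h := by
        rw [mem_logDer, sum_smul_derivation_apply]
        exact hc
      refine ⟨fun k => b.repr ⟨_, hδ⟩ k, funext fun i => ?_⟩
      have e := hrepr ⟨_, hδ⟩ (coord i)
      rw [sum_smul_derivation_apply] at e
      simp only [partialDeriv_coord, mul_ite, mul_one, mul_zero, Finset.sum_ite_eq,
        Finset.mem_univ, if_true] at e
      rw [e]
      exact Finset.sum_congr rfl fun k _ => mul_comm _ _)
    hunit
    (fun r hr => mem_one_iff_restrict.1 (hf r (mem_one_div_jacobianIdeal.2 hr)))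
  rw [coeSubmodule_jacobianIdeal]
  refine Submodule.sum_mem _ fun i _ => ?_
  have e : restrict h (a i) * restrict h (partialDeriv i h) =
      Ideal.Quotient.mk (Ideal.span {h}) (a i) • restrict h (partialDeriv i h) := by
    rw [Algebra.smul_def]
    rfl
  rw [e]
  exact Submodule.smul_mem _ _ (Submodule.subset_span ⟨i, rfl⟩)

end Reflexive

/-! ### Biduality for the normalization -/

section Normalization

/-- An element stabilizing a finitely generated submodule that contains a unit is integral. -/
lemma isIntegral_of_mul_mem {A K : Type*} [CommRing A] [CommRing K] [Algebra A K]
    {C : Submodule A K} (hC : C.FG) {s : K} (hs : s ∈ C) (hu : IsUnit s) {f : K}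
    (hf : ∀ x ∈ C, f * x ∈ C) : IsIntegral A f := by
  have : Module.Finite A C := Module.Finite.iff_fg.2 hC
  set φ : Module.End A C := (LinearMap.mulLeft A f).restrict hf with hφ
  obtain ⟨p, hp, hp0⟩ := LinearMap.exists_monic_and_aeval_eq_zero A φ
  have key : ∀ (q : Polynomial A) (x : C), ((Polynomial.aeval φ q x : C) : K) =
      Polynomial.aeval f q * (x : K) := by
    intro q x
    induction q using Polynomial.induction_on' with
    | add p q hp hq => simp [add_mul, hp, hq]
    | monomial m a =>
      have hpow : ∀ m : ℕ, (((φ ^ m) x : C) : K) = f ^ m * x := by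
        intro m
        induction m with
        | zero => simp
        | succ m ih =>
          rw [pow_succ', Module.End.mul_apply, pow_succ', mul_assoc, ← ih]
          rfl
      simp [Polynomial.aeval_monomial, hpow, Algebra.smul_def, mul_assoc]
  refine ⟨p, hp, ?_⟩
  -- p(φ) = 0 gives p(f) s = 0, and the unit s cancels.
  have e := key p ⟨s, hs⟩
  rw [hp0] at e
  exact hu.mul_left_eq_zero.1 (e.symm.trans (by simp))

variable {n : ℕ} {h : OS n}

lemma normalization_le_one_div_conductor : normalization h ≤ 1 / conductor h := by
  rw [Submodule.le_div_iff]
  intro x hx z hz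
  rw [mul_comm]
  exact Submodule.mem_div_iff_forall_mul_mem.1 hz x hx

/-- The normalization is the dual of the conductor, if the latter is finitely generated and
contains a unit of `ℳ_D`. -/
lemma one_div_conductor_le (hfg : (conductor h).FG) {s : MD h} (hs : s ∈ conductor h)
    (hu : IsUnit s) : 1 / conductor h ≤ normalization h := by
  intro f hf
  rw [Submodule.mem_div_iff_forall_mul_mem] at hf
  refine isIntegral_of_mul_mem hfg hs hu fun x hx => ?_
  rw [conductor, Submodule.mem_div_iff_forall_mul_mem]
  intro y hy
  rw [mul_assoc]
  -- For x in the conductor and y in the normalization, x y is again in the conductor, so f x y lies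
  -- in `OD h`.
  refine hf _ ?_
  rw [conductor, Submodule.mem_div_iff_forall_mul_mem] at hx ⊢
  intro z hz
  rw [mul_assoc]
  exact hx _ ((integralClosure (OD h) (MD h)).mul_mem hy hz)

end Normalization

end LogResidue

end

theorem corollary3p7 (n : ℕ) (h : LogResidue.OS n) (h_ne : h ≠ 0)
    (h_zero : MvPowerSeries.constantCoeff (LogResidue.taylor n h) = 0)
    (h_red : IsReduced (LogResidue.OD h)) (h_free : LogResidue.IsFreeDivisor h) :
    LogResidue.residues h = LogResidue.normalization h ↔
      IsLocalization.coeSubmodule (LogResidue.MD h) (LogResidue.jacobianIdeal h) =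
        LogResidue.conductor h := by
  rw [LogResidue.residues_eq_one_div h_ne]
  constructor
  · intro H
    rw [LogResidue.conductor, ← H]
    refine le_antisymm ?_ (LogResidue.one_div_one_div_le h_ne h_red h_free)
    rw [Submodule.le_div_iff]
    intro x hx z hz
    rw [mul_comm]
    exact Submodule.mem_div_iff_forall_mul_mem.1 hz x hx
  · intro H
    obtain ⟨s, hsJ, hs⟩ :=
      LogResidue.exists_mem_jacobianIdeal_nonZeroDivisors h_ne h_red
    have hmem : algebraMap _ (LogResidue.MD h) s ∈ LogResidue.conductor h :=
      H ▸ (IsLocalization.mem_coeSubmodule _ _).2 ⟨s, hsJ, rfl⟩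
    -- Finite generation is inherited from the Jacobian ideal through `H`, so finiteness of the
    -- normalization is not needed.
    have hfg : (LogResidue.conductor h).FG := by
      rw [← H, LogResidue.coeSubmodule_jacobianIdeal]
      exact Submodule.fg_span (Set.finite_range _)
    rw [H]
    exact le_antisymm
      (LogResidue.one_div_conductor_le hfg hmem (IsLocalization.map_units _ (⟨s, hs⟩ :
        nonZeroDivisors (LogResidue.OD h))))
      LogResidue.normalization_le_one_div_conductor
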